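/- Let $A=\{a_1,\dots,a_k\}$ be an alphabet of cardinality $k$ and $A^*$ the set of words over $A$, including the empty word. A right ideal is a set $R\subseteq A^*$ with $RA^*\subseteq R$; it is finitely generated if $R=CA^*$ for some finite $C$. A right ideal homomorphism is a map $\varphi:R\to A^*$, defined on a right ideal $R$, with $\varphi(xw)=\varphi(x)w$ for all $x\in R$, $w\in A^*$; it is an isomorphism (onto its image) if it is injective. A homomorphism $\psi:R'\to A^*$ is an essential extension of $\varphi:R\to A^*$ if $R\subseteq R'$, $\psi|_R=\varphi$, and $R$ meets every non-empty right ideal contained in $R'$. Every homomorphism $\varphi$ with finitely generated domain has a unique maximal essential extension $\max(\varphi)$. The Thompson-Higman monoid $M_{k,1}$ consists of all $\max(\varphi)$, where $\varphi$ ranges over the homomorphisms between finitely generated right ideals (the empty map included), with multiplication $\varphi\cdot\psi=\max(\varphi\circ\psi)$; the submonoid ${\it Inv}_{k,1}$ consists of all $\max(\varphi)$ with $\varphi$ injective. We say that an element of $M_{k,1}$ has a table $P\to Q$, where $P,Q\subset A^*$ are finite prefix codes (no element of the set is a proper prefix of another one), if it equals $\max(\alpha)$ for some homomorphism $\alpha$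 with domain $PA^*$ and $\alpha(P)=Q$. Theorem. The monoid $M_{k,1}$ is finitely generated. More precisely: (1) Every element of $M_{k,1}$ is a product of finitely many elements $\varphi_i\in M_{k,1}$ that have tables $P_i\to Q_i$, with $P_i,Q_i$ finite prefix codes, such that $0\le |P_i|-|Q_i|\le 1$. (2) There are a finite generating set $S$ of the monoid ${\it Inv}_{k,1}$ and a set $T\subseteq M_{k,1}$ with at most $k$ elements such that $S\cup T$ generates $M_{k,1}$. -/

import Mathlib

namespace ThompsonHigman

/-- Words over the alphabet `{a_1, …, a_k}`; concatenation is `++`, the prefix order is `<+:`. -/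
abbrev Word (k : ℕ) : Type := List (Fin k)

/-- A right ideal of the free monoid. -/
def IsRightIdeal {k : ℕ} (R : Set (Word k)) : Prop :=
  ∀ x ∈ R, ∀ w : Word k, x ++ w ∈ R

/-- The right ideal `C A*` generated by a set `C` of words. -/
def rightIdealOf {k : ℕ} (C : Set (Word k)) : Set (Word k) :=
  {x | ∃ c ∈ C, ∃ w : Word k, x = c ++ w}

/-- `R'` is essential in `R`: it is contained in `R` and meets every (non-empty) right ideal
contained in `R`. -/
def EssentialIn {k : ℕ} (R' R : Set (Word k)) : Prop :=
  R' ⊆ R ∧ ∀ J : Set (Word k), IsRightIdeal J → J.Nonempty → J ⊆ R → (J ∩ R').Nonempty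

/-- Prefix codes: no element is a prefix of another one. -/
def IsPrefixCode {k : ℕ} (P : Set (Word k)) : Prop :=
  ∀ x ∈ P, ∀ y ∈ P, x <+: y → x = y

/-- The domain of a partial function on words (`none` means undefined). -/
def domain {k : ℕ} (f : Word k → Option (Word k)) : Set (Word k) :=
  {x | ∃ y, f x = some y}

/-- `RI k`: the right ideal homomorphisms whose domain is a finitely generated right ideal,
as partial functions on words. The first law contains that the domain is a right ideal. The image
is then automatically a finitely generated right ideal. The empty map is included. -/
@[ext]
structure RI (k : ℕ) where
  toFun : Word k → Option (Word k)
  map_append : ∀ x y w : Word k, toFun x = some y → toFun (x ++ w) = some (y ++ w)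
  fg : ∃ C : Set (Word k), C.Finite ∧ domain toFun = rightIdealOf C

instance (k : ℕ) : CoeFun (RI k) (fun _ => Word k → Option (Word k)) := ⟨RI.toFun⟩

namespace RI

/-- The domain `Dom(φ)`. -/
def Dom {k : ℕ} (φ : RI k) : Set (Word k) := domain φ.toFun

/-- `ψ` is an essential extension of `φ`. -/
def IsEssentialExtension {k : ℕ} (ψ φ : RI k) : Prop :=
  EssentialIn φ.Dom ψ.Dom ∧ ∀ x ∈ φ.Dom, ψ x = φ x

/-- `φ` has no proper essential extension. -/
def IsMaximal {k : ℕ} (φ : RI k) : Prop :=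
  ∀ ψ : RI k, ψ.IsEssentialExtension φ → ψ = φ

/-- `φ` is injective on its domain. -/
def IsInjective {k : ℕ} (φ : RI k) : Prop :=
  ∀ x x' y : Word k, φ x = some y → φ x' = some y → x = x'

theorem isRightIdeal_dom {k : ℕ} (φ : RI k) : IsRightIdeal φ.Dom := by
  rintro x ⟨y, hy⟩ w
  exact ⟨_, φ.map_append x y w hy⟩

/-- A criterion for finite generation of a domain: it is generated by its short words. -/
theorem fg_of_bound {k : ℕ} (f : Word k → Option (Word k))
    (hf : ∀ x y w : Word k, f x = some y → f (x ++ w) = some (y ++ w)) (N : ℕ)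
    (hN : ∀ x ∈ domain f, ∃ c ∈ domain f, c.length ≤ N ∧ c <+: x) :
    ∃ C : Set (Word k), C.Finite ∧ domain f = rightIdealOf C := by
  refine ⟨{c | c ∈ domain f ∧ c.length ≤ N},
    (List.finite_length_le (Fin k) N).subset fun c hc => hc.2, ?_⟩
  ext x
  constructor
  · intro hx
    obtain ⟨c, hc, hl, w, rfl⟩ := hN x hx
    exact ⟨c, ⟨hc, hl⟩, w, rfl⟩
  · rintro ⟨c, ⟨⟨y, hy⟩, -⟩, w, rfl⟩
    exact ⟨_, hf c y w hy⟩

theorem exists_bound {k : ℕ} (φ : RI k) :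
    ∃ N : ℕ, ∀ x ∈ φ.Dom, ∃ c ∈ φ.Dom, c.length ≤ N ∧ c <+: x := by
  obtain ⟨C, hC, h⟩ := φ.fg
  obtain ⟨N, hN⟩ := (hC.image List.length).bddAbove
  refine ⟨N, fun x hx => ?_⟩
  have hx' : x ∈ rightIdealOf C := h ▸ hx
  obtain ⟨c, hc, w, rfl⟩ := hx'
  refine ⟨c, ?_, hN ⟨c, hc, rfl⟩, w, rfl⟩
  have : c ∈ rightIdealOf C := ⟨c, hc, [], by simp⟩
  rw [← h] at this
  exact this

/-- The identity map on all words. -/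
def id (k : ℕ) : RI k where
  toFun x := some x
  map_append := by
    intro x y w h
    simp only [Option.some.injEq] at h
    rw [h]
  fg := fg_of_bound _ (by
    intro x y w h
    simp only [Option.some.injEq] at h
    rw [h]) 0 fun x _ => ⟨[], ⟨[], rfl⟩, by simp, List.nil_prefix⟩

theorem comp_map_append {k : ℕ} (φ ψ : RI k) (x y w : Word k)
    (h : (ψ x).bind φ.toFun = some y) : (ψ (x ++ w)).bind φ.toFun = some (y ++ w) := by
  rw [Option.bind_eq_some_iff] at h ⊢
  obtain ⟨z, hz, hy⟩ := h
  exact ⟨z ++ w, ψ.map_append x z w hz, φ.map_append z y w hy⟩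

/-- Composition `φ ∘ ψ` of partial functions: first `ψ`, then `φ`. -/
def comp {k : ℕ} (φ ψ : RI k) : RI k where
  toFun x := (ψ x).bind φ.toFun
  map_append := comp_map_append φ ψ
  fg := by
    obtain ⟨N, hN⟩ := φ.exists_bound
    obtain ⟨L, hL⟩ := ψ.exists_bound
    refine fg_of_bound _ (comp_map_append φ ψ) (L + N) ?_
    rintro x ⟨y, hy⟩
    rw [Option.bind_eq_some_iff] at hy
    obtain ⟨z, hz, hy⟩ := hy
    obtain ⟨p, ⟨q, hq⟩, hl, w, rfl⟩ := hL x ⟨z, hz⟩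
    have hz' := ψ.map_append p q w hq
    rw [hz] at hz'
    obtain rfl := Option.some.inj hz'
    obtain ⟨c, ⟨d, hd⟩, hcl, hc⟩ := hN _ ⟨y, hy⟩
    have hc' : c <+: q ++ w.take N := by
      refine List.prefix_of_prefix_length_le hc
        ((List.prefix_append_right_inj q).2 (List.take_prefix N w)) ?_
      have h1 := hc.length_le
      simp only [List.length_append, List.length_take] at h1 ⊢
      omega
    obtain ⟨u, hu⟩ := hc'
    refine ⟨p ++ w.take N, ⟨d ++ u, ?_⟩, ?_, ?_⟩
    · rw [Option.bind_eq_some_iff]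
      refine ⟨q ++ w.take N, ψ.map_append p q _ hq, ?_⟩
      rw [← hu]
      exact φ.map_append c d u hd
    · simp only [List.length_append, List.length_take]
      omega
    · exact (List.prefix_append_right_inj p).2 (List.take_prefix N w)

/-- `φ` eventually sends `x` to `y`: every extension `x w` of `x` has a further extension at which
`φ` acts by replacing the prefix `x` by `y`. -/
def EventuallyMaps {k : ℕ} (φ : RI k) (x y : Word k) : Prop :=
  ∀ w : Word k, ∃ v : Word k, φ (x ++ w ++ v) = some (y ++ w ++ v)

theorem EventuallyMaps.unique {k : ℕ} {φ : RI k} {x y y' : Word k}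
    (h : φ.EventuallyMaps x y) (h' : φ.EventuallyMaps x y') : y = y' := by
  obtain ⟨v, hv⟩ := h []
  obtain ⟨v', hv'⟩ := h' v
  have h2 := φ.map_append _ _ v' hv
  simp only [List.append_nil] at h2
  rw [hv'] at h2
  simpa using (Option.some.inj h2).symm

theorem EventuallyMaps.append {k : ℕ} {φ : RI k} {x y : Word k}
    (h : φ.EventuallyMaps x y) (u : Word k) : φ.EventuallyMaps (x ++ u) (y ++ u) := by
  intro w
  obtain ⟨v, hv⟩ := h (u ++ w)
  exact ⟨v, by simpa using hv⟩

theorem eventuallyMaps_of_eq {k : ℕ} {φ : RI k} {x y : Word k}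
    (h : φ x = some y) : φ.EventuallyMaps x y := by
  intro w
  exact ⟨[], by simpa using φ.map_append x y w h⟩

open Classical in
/-- The underlying partial function of the maximal essential extension. -/
noncomputable def maxFun {k : ℕ} (φ : RI k) (x : Word k) : Option (Word k) :=
  if h : ∃ y, φ.EventuallyMaps x y then some h.choose else none

theorem maxFun_eq_some {k : ℕ} {φ : RI k} {x y : Word k} :
    φ.maxFun x = some y ↔ φ.EventuallyMaps x y := by
  unfold maxFun
  constructor
  · intro h
    split_ifs at h with hx
    obtain rfl := Option.some.inj h
    exact hx.choose_spec
  · intro h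
    have hx : ∃ y, φ.EventuallyMaps x y := ⟨y, h⟩
    rw [dif_pos hx]
    exact congrArg some (hx.choose_spec.unique h)

theorem maxFun_map_append {k : ℕ} (φ : RI k) (x y w : Word k)
    (h : φ.maxFun x = some y) : φ.maxFun (x ++ w) = some (y ++ w) := by
  rw [maxFun_eq_some] at h ⊢
  exact h.append w

/-- The maximal essential extension `max(φ)` of `φ`; see `eq_max_iff` below. -/
noncomputable def max {k : ℕ} (φ : RI k) : RI k where
  toFun := φ.maxFun
  map_append := maxFun_map_append φ
  fg := by
    obtain ⟨N, hN⟩ := φ.exists_bound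
    refine fg_of_bound _ (maxFun_map_append φ) N ?_
    rintro x ⟨y, hy⟩
    rcases le_total x.length N with hl | hl
    · exact ⟨x, ⟨y, hy⟩, hl, List.prefix_rfl⟩
    · obtain ⟨v, hv⟩ := maxFun_eq_some.1 hy []
      obtain ⟨c, ⟨d, hd⟩, hcl, hc⟩ := hN _ ⟨_, hv⟩
      refine ⟨c, ⟨d, maxFun_eq_some.2 (eventuallyMaps_of_eq hd)⟩, hcl, ?_⟩
      refine List.prefix_of_prefix_length_le hc ?_ (hcl.trans hl)
      simp

theorem max_apply {k : ℕ} {φ : RI k} {x y : Word k} :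
    φ.max x = some y ↔ φ.EventuallyMaps x y := maxFun_eq_some

/-- Essential extensions, in terms of words. -/
theorem isEssentialExtension_iff {k : ℕ} {ψ φ : RI k} :
    ψ.IsEssentialExtension φ ↔ (∀ x y, φ x = some y → ψ x = some y) ∧
      ∀ x y, ψ x = some y → ∃ v, φ (x ++ v) = some (y ++ v) := by
  constructor
  · rintro ⟨⟨-, h2⟩, h3⟩
    have h4 : ∀ x y, φ x = some y → ψ x = some y := fun x y h => (h3 x ⟨y, h⟩).trans h
    refine ⟨h4, fun x y h => ?_⟩
    obtain ⟨z, ⟨v, rfl⟩, u, hu⟩ := h2 {z | x <+: z}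
      (fun z hz w => hz.trans (List.prefix_append z w)) ⟨x, List.prefix_rfl⟩ (by
        rintro z ⟨v, rfl⟩
        exact ⟨_, ψ.map_append x y v h⟩)
    refine ⟨v, ?_⟩
    rw [hu, ← h4 _ _ hu, ψ.map_append x y v h]
  · rintro ⟨h1, h2⟩
    refine ⟨⟨fun x ⟨y, h⟩ => ⟨y, h1 x y h⟩, ?_⟩, fun x ⟨y, h⟩ => (h1 x y h).trans h.symm⟩
    rintro J hJ ⟨x, hx⟩ hJR
    obtain ⟨y, hy⟩ := hJR hx
    obtain ⟨v, hv⟩ := h2 x y hy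
    exact ⟨x ++ v, hJ x hx v, _, hv⟩

theorem ext_some {k : ℕ} {φ ψ : RI k} (h : ∀ x y, φ x = some y ↔ ψ x = some y) : φ = ψ :=
  RI.ext (funext fun x => Option.ext fun y => h x y)

theorem max_isEssentialExtension {k : ℕ} (φ : RI k) : φ.max.IsEssentialExtension φ := by
  rw [isEssentialExtension_iff]
  refine ⟨fun x y h => max_apply.2 (eventuallyMaps_of_eq h), fun x y h => ?_⟩
  obtain ⟨v, hv⟩ := max_apply.1 h []
  exact ⟨v, by simpa using hv⟩

/-- Essentially equal homomorphisms have the same maximal essential extension. -/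
theorem max_eq_of_isEssentialExtension {k : ℕ} {ψ φ : RI k}
    (h : ψ.IsEssentialExtension φ) : ψ.max = φ.max := by
  rw [isEssentialExtension_iff] at h
  refine ext_some fun x y => ?_
  rw [max_apply, max_apply]
  constructor
  · intro hx w
    obtain ⟨v, hv⟩ := hx w
    obtain ⟨v', hv'⟩ := h.2 _ _ hv
    exact ⟨v ++ v', by simpa using hv'⟩
  · intro hx w
    obtain ⟨v, hv⟩ := hx w
    exact ⟨v, h.1 _ _ hv⟩

theorem eq_max_of_isMaximal {k : ℕ} {φ : RI k} (h : φ.IsMaximal) : φ.max = φ :=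
  h _ φ.max_isEssentialExtension

theorem max_isMaximal {k : ℕ} (φ : RI k) : φ.max.IsMaximal := by
  intro ψ h
  have h1 : ψ.max = φ.max :=
    (max_eq_of_isEssentialExtension h).trans
      (max_eq_of_isEssentialExtension φ.max_isEssentialExtension)
  have h2 := isEssentialExtension_iff.1 h
  refine ext_some fun x y => ⟨fun hx => ?_, fun hx => h2.1 x y hx⟩
  rw [← h1]
  exact max_apply.2 (eventuallyMaps_of_eq hx)

/-- `max(φ)` is the unique maximal essential extension of `φ`. -/
theorem eq_max_iff {k : ℕ} (φ ψ : RI k) :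
    ψ.IsMaximal ∧ ψ.IsEssentialExtension φ ↔ ψ = φ.max := by
  constructor
  · rintro ⟨h1, h2⟩
    rw [← max_eq_of_isEssentialExtension h2, eq_max_of_isMaximal h1]
  · rintro rfl
    exact ⟨φ.max_isMaximal, φ.max_isEssentialExtension⟩

theorem max_max_comp {k : ℕ} (φ ψ : RI k) : (φ.max.comp ψ).max = (φ.comp ψ).max := by
  refine max_eq_of_isEssentialExtension (isEssentialExtension_iff.2 ⟨?_, ?_⟩)
  · intro x y h
    obtain ⟨z, hz, hy⟩ := Option.bind_eq_some_iff.1 h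
    exact Option.bind_eq_some_iff.2 ⟨z, hz, max_apply.2 (eventuallyMaps_of_eq hy)⟩
  · intro x y h
    obtain ⟨z, hz, hy⟩ := Option.bind_eq_some_iff.1 h
    obtain ⟨v, hv⟩ := (isEssentialExtension_iff.1 φ.max_isEssentialExtension).2 _ _ hy
    exact ⟨v, Option.bind_eq_some_iff.2 ⟨z ++ v, ψ.map_append _ _ _ hz, hv⟩⟩

theorem max_comp_max {k : ℕ} (φ ψ : RI k) : (φ.comp ψ.max).max = (φ.comp ψ).max := by
  refine max_eq_of_isEssentialExtension (isEssentialExtension_iff.2 ⟨?_, ?_⟩)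
  · intro x y h
    obtain ⟨z, hz, hy⟩ := Option.bind_eq_some_iff.1 h
    exact Option.bind_eq_some_iff.2 ⟨z, max_apply.2 (eventuallyMaps_of_eq hz), hy⟩
  · intro x y h
    obtain ⟨z, hz, hy⟩ := Option.bind_eq_some_iff.1 h
    obtain ⟨v, hv⟩ := (isEssentialExtension_iff.1 ψ.max_isEssentialExtension).2 _ _ hz
    exact ⟨v, Option.bind_eq_some_iff.2 ⟨z ++ v, hv, φ.map_append _ _ _ hy⟩⟩

theorem comp_assoc {k : ℕ} (φ ψ χ : RI k) : (φ.comp ψ).comp χ = φ.comp (ψ.comp χ) := by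
  refine RI.ext (funext fun x => ?_)
  exact (Option.bind_assoc (χ x) ψ.toFun φ.toFun).symm

theorem id_comp {k : ℕ} (φ : RI k) : (id k).comp φ = φ :=
  RI.ext (funext fun x => Option.bind_fun_some (φ x))

theorem comp_id {k : ℕ} (φ : RI k) : φ.comp (id k) = φ := rfl

theorem id_isInjective (k : ℕ) : (id k).IsInjective := by
  intro x x' y h h'
  exact (Option.some.inj h).trans (Option.some.inj h').symm

theorem IsInjective.comp {k : ℕ} {φ ψ : RI k} (hφ : φ.IsInjective) (hψ : ψ.IsInjective) :
    (φ.comp ψ).IsInjective := by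
  intro x x' y h h'
  obtain ⟨z, hz, hy⟩ := Option.bind_eq_some_iff.1 h
  obtain ⟨z', hz', hy'⟩ := Option.bind_eq_some_iff.1 h'
  obtain rfl := hφ z z' y hy hy'
  exact hψ x x' z hz hz'

/-- `P → Q` is the table of `φ`: `P` is the prefix code that generates the domain of `φ`, and the
prefix code `Q` is the image of `P` under `φ`. -/
def IsTable {k : ℕ} (φ : RI k) (P Q : Finset (Word k)) : Prop :=
  IsPrefixCode (P : Set (Word k)) ∧ IsPrefixCode (Q : Set (Word k)) ∧
    φ.Dom = rightIdealOf (P : Set (Word k)) ∧ ∀ y, y ∈ Q ↔ ∃ x ∈ P, φ x = some y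

end RI

/-- The Thompson-Higman partial function monoid `M_{k,1}`: all maximal essential extensions of
homomorphisms between finitely generated right ideals, i.e. all elements of `RI k` without proper
essential extension. -/
def M (k : ℕ) : Type := {φ : RI k // φ.IsMaximal}

/-- The map `max` from `RI k` onto `M k`. -/
noncomputable def toM {k : ℕ} (φ : RI k) : M k := ⟨φ.max, φ.max_isMaximal⟩

/-- The multiplication is composition followed by maximal essential extension. -/
noncomputable instance (k : ℕ) : Mul (M k) := ⟨fun φ ψ => toM (φ.1.comp ψ.1)⟩

noncomputable instance (k : ℕ) : One (M k) := ⟨toM (RI.id k)⟩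

theorem toM_val {k : ℕ} (φ : M k) : toM φ.1 = φ := Subtype.ext (RI.eq_max_of_isMaximal φ.2)

theorem toM_mul {k : ℕ} (φ ψ : RI k) : toM φ * toM ψ = toM (φ.comp ψ) :=
  Subtype.ext ((RI.max_max_comp φ ψ.max).trans (RI.max_comp_max φ ψ))

noncomputable instance (k : ℕ) : Monoid (M k) where
  mul_assoc φ ψ χ := by
    rw [← toM_val φ, ← toM_val ψ, ← toM_val χ, toM_mul, toM_mul, toM_mul, toM_mul, RI.comp_assoc]
  one_mul φ := by
    rw [← toM_val φ]
    exact (toM_mul _ _).trans (congrArg toM (RI.id_comp φ.1))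
  mul_one φ := by
    rw [← toM_val φ]
    exact (toM_mul _ _).trans (congrArg toM (RI.comp_id φ.1))

/-- The Thompson-Higman inverse monoid `Inv_{k,1}`: all maximal essential extensions of
isomorphisms between finitely generated right ideals, as a submonoid of `M_{k,1}`. -/
def Inv (k : ℕ) : Submonoid (M k) where
  carrier := {φ | ∃ α : RI k, α.IsInjective ∧ toM α = φ}
  one_mem' := ⟨RI.id k, RI.id_isInjective k, rfl⟩
  mul_mem' := by
    rintro _ _ ⟨α, hα, rfl⟩ ⟨β, hβ, rfl⟩
    exact ⟨α.comp β, hα.comp hβ, (toM_mul α β).symm⟩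

/-- `φ` has a table `P → Q` with `P` and `Q` finite prefix codes (tables of an element of `M_{k,1}`
are taken up to essential restriction) such that `0 ≤ |P| - |Q| ≤ 1`. -/
def CollapsesAtMostOne {k : ℕ} (φ : M k) : Prop :=
  ∃ (α : RI k) (P Q : Finset (Word k)), toM α = φ ∧ α.IsTable P Q ∧
    Q.card ≤ P.card ∧ P.card ≤ Q.card + 1

end ThompsonHigman

namespace ThompsonHigman

namespace RI

variable {k : ℕ}

/-! Given two distinct letters `a`, `b`, a list of words l is encoded as the homomorphism `enum a b
l`, which sends b^i a w to l_i w. If l lists the prefix code of the domain of φ, then φ ∘ enum l =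
enum (φ l) and enum l is injective, so φ = enum (φ l) ∘ (enum l)⁻¹ (`eq_comp_inverse`). It remains
to build enumerations, and inverses of those of prefix codes, from finitely many maps.

Composing on the right with a fixed map edits the list: `prepend [b]` deletes the head, `expand`
replaces a head u by u a_1, …, u a_k, `swap` exchanges the first two entries, `fold` duplicates the
head. Transpositions deeper in the list arise by conjugation with `rotate` (`below_below`), so all
permutations are available. From the list whose only entry is the empty word, these edits without
`fold` reach every prefix code (`enum_refine`), and with `fold` every list (`enum_of_fold`). An
injective φ maps its prefix code to a prefix code, so the first fact generates `Inv k`; the second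
generates `M k`. The list argument serves both purposes because it is stated for an abstract
predicate `IsGenerated`.

Over at most one letter every homomorphism is injective, and a nonempty one is determined, up to
essential extension, by a single value. The table bound holds for the generators: injective maps
preserve the size of a prefix code, and `fold` takes three words to two. -/

theorem comp_eq_some {φ ψ : RI k} {x y : Word k} :
    (φ.comp ψ) x = some y ↔ ∃ z, ψ x = some z ∧ φ z = some y :=
  Option.bind_eq_some_iff

/-- The empty map. -/
def zero (k : ℕ) : RI k where
  toFun _ := none
  map_append := by simp
  fg := ⟨∅, Set.finite_empty, by simp [domain, rightIdealOf]⟩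

/-- Left multiplication by the word `v`. -/
def prepend (v : Word k) : RI k where
  toFun x := some (v ++ x)
  map_append := by
    intro x y w h
    simp only [Option.some.injEq] at h
    simp [← h]
  fg := fg_of_bound _ (by
    intro x y w h
    simp only [Option.some.injEq] at h
    simp [← h]) 0 fun x _ => ⟨[], ⟨_, rfl⟩, by simp, List.nil_prefix⟩

@[simp] theorem prepend_apply (v x : Word k) : prepend v x = some (v ++ x) := rfl

@[simp] theorem zero_apply (x : Word k) : zero k x = none := rfl

theorem comp_prepend_apply (φ : RI k) (v x : Word k) :
    (φ.comp (prepend v)) x = φ (v ++ x) := rfl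

theorem prepend_comp_prepend (u v : Word k) :
    (prepend u).comp (prepend v) = prepend (u ++ v) :=
  ext_some fun x y => by simp [comp_eq_some]

theorem prepend_isInjective (v : Word k) : (prepend v).IsInjective := by
  intro x x' y h h'
  simpa using (Option.some.inj h).trans (Option.some.inj h').symm

theorem comp_zero (φ : RI k) : φ.comp (zero k) = zero k :=
  ext_some fun x y => by simp [comp_eq_some]

/-! ### Maps that branch on two letters, and the list-editing maps. -/

/-- The function that sends `a w` to `q w` and `b w` to `f w`. -/
def branchFun (a b : Fin k) (q : Word k) (f : Word k → Option (Word k)) :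
    Word k → Option (Word k)
  | [] => none
  | c :: w => if c = a then some (q ++ w) else if c = b then f w else none

theorem branchFun_map_append (a b : Fin k) (q : Word k) (f : RI k) (x y w : Word k)
    (h : branchFun a b q f x = some y) : branchFun a b q f (x ++ w) = some (y ++ w) := by
  cases x with
  | nil => simp [branchFun] at h
  | cons c x =>
    simp only [branchFun, List.cons_append] at h ⊢
    split_ifs at h ⊢ with h1 h2
    · simp only [Option.some.injEq] at h
      simp [← h]
    · exact f.map_append _ _ _ h

/-- The homomorphism that sends `a w` to `q w` and `b w` to `f w`. -/
def branch (a b : Fin k) (q : Word k) (f : RI k) : RI k where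
  toFun := branchFun a b q f
  map_append := branchFun_map_append a b q f
  fg := by
    obtain ⟨N, hN⟩ := f.exists_bound
    refine fg_of_bound _ (branchFun_map_append a b q f) (N + 1) ?_
    rintro (_ | ⟨c, x⟩) ⟨y, h⟩
    · simp [branchFun] at h
    · simp only [branchFun] at h
      split_ifs at h with h1 h2
      · exact ⟨[c], ⟨q, by simp [branchFun, h1]⟩, by simp, by simp⟩
      · obtain ⟨d, ⟨z, hz⟩, hl, hd⟩ := hN x ⟨y, h⟩
        refine ⟨c :: d, ⟨z, ?_⟩, by simpa using hl, by simpa using hd⟩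
        simp only [branchFun, if_neg h1, if_pos h2]
        exact hz

section Branch

variable {a b : Fin k}

@[simp] theorem branch_nil (q : Word k) (f : RI k) : branch a b q f [] = none := rfl

@[simp] theorem branch_left (q : Word k) (f : RI k) (w : Word k) :
    branch a b q f (a :: w) = some (q ++ w) := by
  simp [branch, branchFun]

theorem branch_right (hab : a ≠ b) (q : Word k) (f : RI k) (w : Word k) :
    branch a b q f (b :: w) = f w := by
  simp [branch, branchFun, hab.symm]

theorem branch_eq_some (hab : a ≠ b) {q : Word k} {f : RI k} {x y : Word k} :
    branch a b q f x = some y ↔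
      (∃ w, x = a :: w ∧ y = q ++ w) ∨ ∃ w, x = b :: w ∧ f w = some y := by
  cases x with
  | nil => simp
  | cons c x =>
    by_cases h1 : c = a
    · subst h1
      simp [hab.symm, eq_comm]
    · by_cases h2 : c = b
      · subst h2
        simp [branch_right hab, h1]
      · simp [branch, branchFun, h1, h2]

/-- Composition on the left acts on labels only, since f sends q w to r w. Together with
`branch_comp_prepend` this rule computes the compositions with the list-editing maps. -/
theorem comp_branch (hab : a ≠ b) {f : RI k} {q r : Word k} (h : f q = some r) (g : RI k) :
    f.comp (branch a b q g) = branch a b r (f.comp g) := by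
  refine ext_some fun x y => ?_
  simp only [comp_eq_some, branch_eq_some hab]
  constructor
  · rintro ⟨z, ⟨w, rfl, rfl⟩ | ⟨w, rfl, hw⟩, hz⟩
    · rw [f.map_append _ _ w h] at hz
      exact Or.inl ⟨w, rfl, (Option.some.inj hz).symm⟩
    · exact Or.inr ⟨w, rfl, z, hw, hz⟩
  · rintro (⟨w, rfl, rfl⟩ | ⟨w, rfl, z, hw, hz⟩)
    · exact ⟨_, Or.inl ⟨w, rfl, rfl⟩, f.map_append _ _ w h⟩
    · exact ⟨z, Or.inr ⟨w, rfl, hw⟩, hz⟩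

theorem branch_comp_prepend (hab : a ≠ b) (q : Word k) (f : RI k) :
    (branch a b q f).comp (prepend [b]) = f :=
  ext_some fun x y => by rw [comp_prepend_apply]; simp [branch_right hab]

theorem branch_isInjective (hab : a ≠ b) {q : Word k} {f : RI k} (hf : f.IsInjective)
    (hq : ∀ x y, f x = some y → ¬ q <+: y) : (branch a b q f).IsInjective := by
  intro x x' y h h'
  rw [branch_eq_some hab] at h h'
  rcases h with ⟨w, rfl, rfl⟩ | ⟨w, rfl, hw⟩ <;> rcases h' with ⟨w', rfl, h'⟩ | ⟨w', rfl, hw'⟩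
  · simpa using h'
  · exact absurd (List.prefix_append q w) (hq _ _ hw')
  · exact absurd (h' ▸ List.prefix_append q w') (hq _ _ hw)
  · rw [hf _ _ _ hw hw']

/-- The homomorphism that sends `b^i a w` to `l_i w` for `i < |l|` and `b^|l| w` to `f w`. -/
def branches (a b : Fin k) (l : List (Word k)) (f : RI k) : RI k := l.foldr (branch a b) f

@[simp] theorem branches_nil (f : RI k) : branches a b [] f = f := rfl

@[simp] theorem branches_cons (q : Word k) (l : List (Word k)) (f : RI k) :
    branches a b (q :: l) f = branch a b q (branches a b l f) := rfl

theorem branches_append (l l' : List (Word k)) (f : RI k) :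
    branches a b (l ++ l') f = branches a b l (branches a b l' f) :=
  List.foldr_append

theorem comp_branches (hab : a ≠ b) {f : RI k} (g : RI k) {l : List (Word k)} (r : Word k → Word k)
    (h : ∀ x ∈ l, f x = some (r x)) :
    f.comp (branches a b l g) = branches a b (l.map r) (f.comp g) := by
  induction l with
  | nil => rfl
  | cons q l ih =>
    simp only [branches_cons, List.map_cons]
    rw [comp_branch hab (h q (by simp)), ih fun x hx => h x (by simp [hx])]

/-- `f` acting below `b`, and the identity below `a`. -/
def below (a b : Fin k) (f : RI k) : RI k := branch a b [a] ((prepend [b]).comp f)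

/-- An edit wrapped in `below` skips the head of a list, so iterating `below` moves the edit further
along the list. -/
theorem branch_comp_below (hab : a ≠ b) (q : Word k) (f g : RI k) :
    (branch a b q f).comp (below a b g) = branch a b q (f.comp g) := by
  rw [below, comp_branch hab (branch_left q f []), ← comp_assoc, branch_comp_prepend hab,
    List.append_nil]

theorem below_isInjective (hab : a ≠ b) {f : RI k} (hf : f.IsInjective) :
    (below a b f).IsInjective := by
  refine branch_isInjective hab ((prepend_isInjective _).comp hf) fun x y h => ?_
  obtain ⟨z, -, hz⟩ := comp_eq_some.1 h
  obtain rfl := Option.some.inj hz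
  simp [hab]

/-- The transposition of `a` and `b a` that fixes `b b`. -/
def swap (a b : Fin k) : RI k := branch a b [b, a] (branch a b [a] (prepend [b, b]))

/-- The map `a ↦ a a`, `b a ↦ a b`, `b b ↦ b`. -/
def rotate (a b : Fin k) : RI k := branch a b [a, a] (branch a b [a, b] (prepend [b]))

/-- The map that sends `b^j a` to `a a_j` for the `j`-th letter `a_j`, and `b^k` to `b`. -/
def expand (a b : Fin k) : RI k :=
  branches a b ((List.finRange k).map fun j => [a, j]) (prepend [b])

/-- The map `a ↦ a`, `b a ↦ a`, `b b ↦ b`. -/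
def fold (a b : Fin k) : RI k := branch a b [a] (branch a b [a] (prepend [b]))

theorem swap_isInjective (hab : a ≠ b) : (swap a b).IsInjective := by
  refine branch_isInjective hab (branch_isInjective hab (prepend_isInjective _) ?_) ?_
  · intro x y h
    obtain rfl := Option.some.inj h
    simp [hab]
  · intro x y h
    rcases (branch_eq_some hab).1 h with ⟨w, rfl, rfl⟩ | ⟨w, rfl, hw⟩
    · simp [hab.symm]
    · obtain rfl := Option.some.inj hw
      simp [hab]

theorem rotate_isInjective (hab : a ≠ b) : (rotate a b).IsInjective := by
  refine branch_isInjective hab (branch_isInjective hab (prepend_isInjective _) ?_) ?_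
  · intro x y h
    obtain rfl := Option.some.inj h
    simp [hab]
  · intro x y h
    rcases (branch_eq_some hab).1 h with ⟨w, rfl, rfl⟩ | ⟨w, rfl, hw⟩
    · simp [hab]
    · obtain rfl := Option.some.inj hw
      simp [hab]

theorem expand_isInjective (hab : a ≠ b) : (expand a b).IsInjective := by
  -- The induction has to track the values as well: they start with b or with a j for a listed
  -- letter j, and the absence of repetitions keeps a new label a j apart from them.
  have key : ∀ js : List (Fin k), js.Nodup →
      (branches a b (js.map fun j => [a, j]) (prepend [b])).IsInjective ∧
      ∀ x y, branches a b (js.map fun j => [a, j]) (prepend [b]) x = some y →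
        (∃ w, y = b :: w) ∨ ∃ j ∈ js, ∃ w, y = a :: j :: w := by
    intro js
    induction js with
    | nil =>
      refine fun _ => ⟨prepend_isInjective _, fun x y h => Or.inl ⟨x, ?_⟩⟩
      exact (Option.some.inj h).symm
    | cons j js ih =>
      intro hn
      obtain ⟨hj, hn⟩ := List.nodup_cons.1 hn
      obtain ⟨h1, h2⟩ := ih hn
      refine ⟨branch_isInjective hab h1 fun x y h => ?_, fun x y h => ?_⟩
      · rcases h2 x y h with ⟨w, rfl⟩ | ⟨i, hi, w, rfl⟩
        · simp [hab]
        · simp only [List.cons_prefix_cons, List.nil_prefix, and_true, true_and]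
          rintro rfl
          exact hj hi
      · rcases (branch_eq_some hab).1 h with ⟨w, rfl, rfl⟩ | ⟨w, rfl, hw⟩
        · exact Or.inr ⟨j, by simp, w, rfl⟩
        · rcases h2 w y hw with h | ⟨i, hi, w, rfl⟩
          · exact Or.inl h
          · exact Or.inr ⟨i, by simp [hi], w, rfl⟩
  exact (key _ (List.nodup_finRange k)).1

theorem branch_comp_swap (hab : a ≠ b) (u v : Word k) (f : RI k) :
    (branch a b u (branch a b v f)).comp (swap a b) = branch a b v (branch a b u f) := by
  rw [swap, comp_branch hab (r := v) (by simp [branch_right hab]),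
    comp_branch hab (r := u) (by simp), ← List.singleton_append, ← prepend_comp_prepend,
    ← comp_assoc, branch_comp_prepend hab, branch_comp_prepend hab]

theorem branch_comp_fold (hab : a ≠ b) (u : Word k) (f : RI k) :
    (branch a b u f).comp (fold a b) = branch a b u (branch a b u f) := by
  rw [fold, comp_branch hab (r := u) (by simp), comp_branch hab (r := u) (by simp),
    branch_comp_prepend hab]

theorem branch_comp_expand (hab : a ≠ b) (u : Word k) (f : RI k) :
    (branch a b u f).comp (expand a b) =
      branches a b ((List.finRange k).map fun j => u ++ [j]) f := by
  -- Each label of `expand` is a word a j; taking the tail strips the a, and the head's value u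
  -- takes its place.
  rw [expand, comp_branches hab _ (fun x => u ++ x.tail), branch_comp_prepend hab, List.map_map]
  · rfl
  · intro x hx
    obtain ⟨j, -, rfl⟩ := List.mem_map.1 hx
    simp

end Branch

/-! ### Inverses of injective homomorphisms. -/

/-- `φ` and `ψ` are inverse partial injections. -/
def IsInverse (φ ψ : RI k) : Prop := ∀ x y, φ x = some y ↔ ψ y = some x

theorem IsInverse.symm {φ ψ : RI k} (h : φ.IsInverse ψ) : ψ.IsInverse φ := fun x y => (h y x).symm

theorem IsInverse.isInjective {φ ψ : RI k} (h : φ.IsInverse ψ) : φ.IsInjective := by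
  intro x x' y hx hx'
  rw [h] at hx hx'
  exact Option.some.inj (hx.symm.trans hx')

theorem IsInverse.comp {φ ψ φ' ψ' : RI k} (h : φ.IsInverse ψ) (h' : φ'.IsInverse ψ') :
    (φ.comp φ').IsInverse (ψ'.comp ψ) := by
  intro x y
  simp only [comp_eq_some, h _ _, h' _ _, and_comm]

open Classical in
/-- The inverse partial function. -/
noncomputable def inverseFun (φ : RI k) (y : Word k) : Option (Word k) :=
  if h : ∃ x, φ x = some y then some h.choose else none

theorem IsInjective.inverseFun_eq_some {φ : RI k} (hφ : φ.IsInjective) {x y : Word k} :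
    φ.inverseFun y = some x ↔ φ x = some y := by
  unfold inverseFun
  constructor
  · intro h
    split_ifs at h with hy
    obtain rfl := Option.some.inj h
    exact hy.choose_spec
  · intro h
    have hy : ∃ x, φ x = some y := ⟨x, h⟩
    rw [dif_pos hy]
    exact congrArg some (hφ _ _ _ hy.choose_spec h)

theorem IsInjective.exists_isInverse {φ : RI k} (hφ : φ.IsInjective) :
    ∃ ψ : RI k, φ.IsInverse ψ := by
  have happ : ∀ x y w : Word k, φ.inverseFun x = some y →
      φ.inverseFun (x ++ w) = some (y ++ w) := by
    intro x y w h
    rw [hφ.inverseFun_eq_some] at h ⊢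
    exact φ.map_append _ _ _ h
  refine ⟨⟨φ.inverseFun, happ, ?_⟩, fun x y => hφ.inverseFun_eq_some.symm⟩
  obtain ⟨C, hC, hdom⟩ := φ.fg
  -- The domain of the inverse is the image of φ, generated by the values on C, so their lengths
  -- bound it. The default `[]` is never taken, as C lies in the domain.
  obtain ⟨N, hN⟩ := (hC.image fun c => ((φ c).getD []).length).bddAbove
  refine fg_of_bound _ happ N ?_
  rintro y ⟨x, hx⟩
  rw [hφ.inverseFun_eq_some] at hx
  have hx' : x ∈ rightIdealOf C := hdom ▸ ⟨y, hx⟩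
  obtain ⟨c, hc, w, rfl⟩ := hx'
  have hc' : c ∈ domain φ.toFun := hdom ▸ ⟨c, hc, [], by simp⟩
  obtain ⟨z, hz⟩ := hc'
  refine ⟨z, ⟨c, hφ.inverseFun_eq_some.2 hz⟩, ?_, w, ?_⟩
  · have := hN ⟨c, hc, rfl⟩
    simpa [hz] using this
  · exact Option.some.inj ((φ.map_append _ _ w hz).symm.trans hx)

open Classical in
/-- The inverse of an injective homomorphism; other homomorphisms are left unchanged. -/
noncomputable def inverse (φ : RI k) : RI k :=
  if h : ∃ ψ : RI k, φ.IsInverse ψ then h.choose else φ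

theorem IsInjective.isInverse_inverse {φ : RI k} (hφ : φ.IsInjective) :
    φ.IsInverse φ.inverse := by
  unfold inverse
  rw [dif_pos hφ.exists_isInverse]
  exact hφ.exists_isInverse.choose_spec

/-- `rotate` carries a and b a into the part below a, which `below a b f` fixes, and carries b b to
b, where f acts. Conjugation therefore pushes the action one level deeper; this is what makes
finitely many generators enough for all transpositions. -/
theorem below_below {a b : Fin k} (hab : a ≠ b) (f : RI k) :
    below a b (below a b f) =
      (rotate a b).inverse.comp ((below a b f).comp (rotate a b)) := by
  have hr : ∀ x y, rotate a b x = some y ↔ (rotate a b).inverse y = some x :=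
    (rotate_isInjective hab).isInverse_inverse
  have h3 : (rotate a b).inverse.comp (prepend [b]) = prepend [b, b] := by
    refine ext_some fun x y => ?_
    rw [comp_prepend_apply, (hr (b :: b :: x) _).1 (by simp [rotate, branch_right hab])]
    simp
  have h4 : (below a b f).comp (rotate a b) =
      branch a b [a, a] (branch a b [a, b] ((below a b f).comp (prepend [b]))) := by
    rw [rotate, comp_branch hab (r := [a, a]) (by simp [below]),
      comp_branch hab (r := [a, b]) (by simp [below])]
  rw [h4, comp_branch hab (r := [a]) ((hr _ _).1 (by simp [rotate])),
    comp_branch hab (r := [b, a]) ((hr _ _).1 (by simp [rotate, branch_right hab]))]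
  simp only [below, branch_comp_prepend hab]
  rw [comp_branch hab (r := [b, a]) (by simp), ← comp_assoc, ← comp_assoc, h3,
    prepend_comp_prepend]
  rfl

end RI
end ThompsonHigman
namespace ThompsonHigman

namespace RI

variable {k : ℕ} {a b : Fin k}

/-! ### Enumerations of lists, and generators as list edits. -/

/-- The map that sends `b^i a w` to `l_i w` for `i < |l|`. -/
def enum (a b : Fin k) (l : List (Word k)) : RI k := branches a b l (zero k)

theorem comp_enum (hab : a ≠ b) {f : RI k} {l : List (Word k)} (r : Word k → Word k)
    (h : ∀ x ∈ l, f x = some (r x)) : f.comp (enum a b l) = enum a b (l.map r) := by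
  rw [enum, comp_branches hab _ r h, comp_zero]
  rfl

theorem exists_enum_eq_some (hab : a ≠ b) {l : List (Word k)} {p : Word k} (hp : p ∈ l) :
    ∃ c, ∀ w, enum a b l (c ++ w) = some (p ++ w) := by
  induction l with
  | nil => simp at hp
  | cons q l ih =>
    rcases List.mem_cons.1 hp with rfl | hp
    · exact ⟨[a], fun w => branch_left _ _ _⟩
    · obtain ⟨c, hc⟩ := ih hp
      exact ⟨b :: c, fun w => (branch_right hab _ _ _).trans (hc w)⟩

theorem branches_comp_below_iterate_swap (hab : a ≠ b) (l : List (Word k)) (u v : Word k)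
    (f : RI k) :
    (branches a b l (branch a b u (branch a b v f))).comp ((below a b)^[l.length] (swap a b)) =
      branches a b l (branch a b v (branch a b u f)) := by
  induction l with
  | nil => exact branch_comp_swap hab u v f
  | cons q l ih =>
    rw [List.length_cons, Function.iterate_succ_apply', branches_cons, branch_comp_below hab, ih]
    rfl

/-- Homomorphisms whose classes generate `Inv k`, together with their inverses. -/
def generators (a b : Fin k) : Set (RI k) :=
  {prepend [b], branch a b [] (zero k), expand a b, swap a b, below a b (swap a b), rotate a b}

theorem isInjective_of_mem_generators (hab : a ≠ b) {g : RI k} (hg : g ∈ generators a b) :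
    g.IsInjective := by
  rcases hg with rfl | rfl | rfl | rfl | rfl | rfl
  · exact prepend_isInjective _
  · exact branch_isInjective hab (by simp [IsInjective]) (by simp)
  · exact expand_isInjective hab
  · exact swap_isInjective hab
  · exact below_isInjective hab (swap_isInjective hab)
  · exact rotate_isInjective hab

/-- `K` is closed under composition, and contains the generators and their inverses. -/
structure IsGenerated (a b : Fin k) (K : RI k → Prop) : Prop where
  comp : ∀ f g, K f → K g → K (f.comp g)
  mem : ∀ g ∈ generators a b, K g
  inverse_mem : ∀ g ∈ generators a b, K g.inverse

/-- Adjacent transpositions generate all permutations. The fixed initial segment m absorbs the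
common head in the `cons` case. -/
theorem perm_of_swap {α : Type*} {P : List α → Prop}
    (h : ∀ l u v l', P (l ++ u :: v :: l') → P (l ++ v :: u :: l')) {l l' : List α}
    (hl : l.Perm l') (m : List α) (hm : P (m ++ l)) : P (m ++ l') := by
  induction hl generalizing m with
  | nil => exact hm
  | cons x _ ih =>
    have := ih (m ++ [x]) (by simpa using hm)
    simpa using this
  | swap x y l => exact h _ _ _ _ hm
  | trans _ _ ih1 ih2 => exact ih2 m (ih1 m hm)

namespace IsGenerated

variable {K : RI k → Prop}

theorem below_iterate_swap (hab : a ≠ b) (hK : IsGenerated a b K) (n : ℕ) :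
    K ((below a b)^[n] (swap a b)) := by
  -- Conjugation by `rotate` only applies once one `below` is present, so depths 0 and 1 are both
  -- taken as generators.
  rcases n with _ | n
  · exact hK.mem _ (by simp [generators])
  · induction n with
    | zero => exact hK.mem _ (by simp [generators])
    | succ n ih =>
      rw [Function.iterate_succ_apply', Function.iterate_succ_apply', below_below hab]
      refine hK.comp _ _ (hK.inverse_mem _ (by simp [generators]))
        (hK.comp _ _ ?_ (hK.mem _ (by simp [generators])))
      rwa [Function.iterate_succ_apply'] at ih

theorem enum_perm (hab : a ≠ b) (hK : IsGenerated a b K) {l l' : List (Word k)}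
    (hl : l.Perm l') (h : K (enum a b l)) : K (enum a b l') := by
  refine perm_of_swap (P := fun l => K (enum a b l)) (fun l u v l' h => ?_) hl [] h
  have := hK.comp _ _ h (hK.below_iterate_swap hab l.length)
  rw [enum, branches_append, branches_cons, branches_cons,
    branches_comp_below_iterate_swap hab] at this
  rwa [enum, branches_append]

theorem enum_tail (hab : a ≠ b) (hK : IsGenerated a b K) {u : Word k} {l : List (Word k)}
    (h : K (enum a b (u :: l))) : K (enum a b l) := by
  have := hK.comp _ _ h (hK.mem (prepend [b]) (by simp [generators]))
  rwa [enum, branches_cons, branch_comp_prepend hab] at this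

theorem enum_expand (hab : a ≠ b) (hK : IsGenerated a b K) {u : Word k} {l : List (Word k)}
    (h : K (enum a b (u :: l))) :
    K (enum a b ((List.finRange k).map (fun j => u ++ [j]) ++ l)) := by
  have := hK.comp _ _ h (hK.mem (expand a b) (by simp [generators]))
  rw [enum, branches_cons, branch_comp_expand hab] at this
  rwa [enum, branches_append]

/-! ### Refinement of a list entry by a prefix code. -/

/-- The words `t` with `j t` in the list `m`. -/
def residual (m : List (Word k)) (j : Fin k) : List (Word k) :=
  m.filterMap fun
    | [] => none
    | i :: t => if i = j then some t else none

theorem mem_residual {m : List (Word k)} {j : Fin k} {t : Word k} :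
    t ∈ residual m j ↔ j :: t ∈ m := by
  unfold residual
  rw [List.mem_filterMap]
  constructor
  · rintro ⟨x, hx, h⟩
    cases x with
    | nil => simp at h
    | cons i s =>
      simp only [Option.ite_none_right_eq_some, Option.some.injEq] at h
      obtain ⟨rfl, rfl⟩ := h
      exact hx
  · intro h
    exact ⟨_, h, by simp⟩

theorem nodup_residual {m : List (Word k)} (hm : m.Nodup) (j : Fin k) :
    (residual m j).Nodup := by
  refine hm.filterMap ?_
  rintro (_ | ⟨i, s⟩) (_ | ⟨i', s'⟩) t h h'
  · rfl
  · simp at h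
  · simp at h'
  · simp only [Option.mem_def, Option.ite_none_right_eq_some, Option.some.injEq] at h h'
    rw [h.1, h.2, h'.1, h'.2]

/-- Nonempty words are sorted by their first letter; classes of different letters are disjoint. -/
theorem perm_flatMap_residual {m : List (Word k)} (hm : m.Nodup) (h : [] ∉ m) :
    ((List.finRange k).flatMap fun j => (residual m j).map (List.cons j)).Perm m := by
  refine (List.perm_ext_iff_of_nodup ?_ hm).2 fun x => ?_
  · refine List.nodup_flatMap.2 ⟨fun j _ => (nodup_residual hm j).map
      (List.cons_injective), ?_⟩
    refine (List.nodup_finRange k).imp fun {i j} hij => ?_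
    intro x hx hx'
    obtain ⟨s, -, rfl⟩ := List.mem_map.1 hx
    obtain ⟨t, -, ht⟩ := List.mem_map.1 hx'
    exact hij (List.cons.inj ht).1.symm
  · cases x with
    | nil => simp [h]
    | cons i t => simp [mem_residual]

/-- The head of an enumeration can be refined by any prefix code. -/
theorem enum_refine (hab : a ≠ b) (hK : IsGenerated a b K) (N : ℕ) :
    ∀ (u : Word k) (l m : List (Word k)), (∀ x ∈ m, x.length ≤ N) → m.Nodup →
      IsPrefixCode {x | x ∈ m} → K (enum a b (u :: l)) →
      K (enum a b (m.map (u ++ ·) ++ l)) := by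
  induction N with
  | zero =>
    intro u l m hN hn _ h
    -- Without repetitions, words of length 0 form the empty list (delete the head) or the list of
    -- the empty word (nothing to do).
    rcases m with _ | ⟨x, _ | ⟨y, m⟩⟩
    · exact hK.enum_tail hab h
    · obtain rfl := List.eq_nil_of_length_eq_zero (Nat.le_zero.1 (hN x (by simp)))
      simpa using h
    · have hx := List.eq_nil_of_length_eq_zero (Nat.le_zero.1 (hN x (by simp)))
      have hy := List.eq_nil_of_length_eq_zero (Nat.le_zero.1 (hN y (by simp)))
      simp [hx, hy] at hn
  | succ N ih =>
    intro u l m hN hn hc h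
    -- The empty word is a prefix of every word, so a prefix code containing it has no other
    -- element.
    by_cases hm : [] ∈ m
    · have : m.Perm [[]] := by
        refine (List.perm_ext_iff_of_nodup hn (by simp)).2 fun x => ?_
        rw [List.mem_singleton]
        exact ⟨fun hx => (hc [] hm x hx List.nil_prefix).symm, fun hx => hx ▸ hm⟩
      refine hK.enum_perm hab ((this.map _).append_right l).symm ?_
      simpa using h
    refine hK.enum_perm hab (((perm_flatMap_residual hn hm).map _).append_right l) ?_
    -- After the head is expanded, the entries u j are refined one letter at a time. Finished pieces
    -- are permuted to the back and join l, which is why l varies in the induction.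
    have key : ∀ (js : List (Fin k)) (l : List (Word k)),
        K (enum a b (js.map (fun j => u ++ [j]) ++ l)) →
        K (enum a b ((js.flatMap fun j => (residual m j).map (List.cons j)).map (u ++ ·) ++ l)) := by
      intro js
      induction js with
      | nil => exact fun l h => h
      | cons j js ihj =>
        intro l h
        have h1 := ih (u ++ [j]) (js.map (fun j => u ++ [j]) ++ l) (residual m j)
          (fun x hx => by simpa using hN _ (mem_residual.1 hx)) (nodup_residual hn j)
          (fun x hx y hy hxy => by
            simpa using hc _ (mem_residual.1 hx) _ (mem_residual.1 hy) (by simpa using hxy)) h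
        have h2 := ihj ((residual m j).map (u ++ [j] ++ ·) ++ l) (hK.enum_perm hab (by
          rw [← List.append_assoc, ← List.append_assoc]
          exact List.perm_append_comm.append_right l) h1)
        refine hK.enum_perm hab ?_ h2
        rw [List.flatMap_cons, List.map_append, ← List.append_assoc]
        refine List.Perm.append_right l (List.perm_append_comm.trans (List.Perm.of_eq ?_))
        simp [Function.comp_def]
    exact key _ _ (hK.enum_expand hab h)

theorem enum_of_isPrefixCode (hab : a ≠ b) (hK : IsGenerated a b K) {l : List (Word k)}
    (hn : l.Nodup) (hl : IsPrefixCode {x | x ∈ l}) : K (enum a b l) := by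
  -- The seed is the list with the empty word alone; the sum of the lengths is a crude common bound.
  have h := hK.enum_refine hab ((l.map List.length).sum) [] [] l
    (fun x hx => List.single_le_sum (by simp) _ (List.mem_map_of_mem hx)) hn hl
    (hK.mem _ (by simp [generators, enum]))
  simpa using h

theorem enum_of_fold (hab : a ≠ b) (hK : IsGenerated a b K) (hf : K (fold a b))
    (l : List (Word k)) : K (enum a b l) := by
  -- A spare empty word stays at the head as a seed: `fold` copies it, one copy is refined to u by
  -- the code {u}, and a transposition restores the other to the front.
  suffices h : K (enum a b ([] :: l)) from hK.enum_tail hab h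
  induction l with
  | nil => exact hK.mem _ (by simp [generators, enum])
  | cons u l ih =>
    have h := hK.comp _ _ ih hf
    rw [enum, branches_cons, branch_comp_fold hab] at h
    have h' := hK.enum_refine hab u.length [] ([] :: l) [u] (by simp) (by simp)
      (by simp [IsPrefixCode]) h
    exact hK.enum_perm hab (List.Perm.swap _ _ _) (by simpa using h')

end IsGenerated

/-! ### Domain codes and the factorization through enumerations. -/

theorem exists_isPrefixCode (φ : RI k) : ∃ P : Finset (Word k),
    IsPrefixCode (P : Set (Word k)) ∧ φ.Dom = rightIdealOf (P : Set (Word k)) := by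
  classical
  obtain ⟨C, hC, hdom⟩ := φ.fg
  -- The code consists of the prefix-minimal generators; every generator has one as a prefix, by
  -- induction on length.
  refine ⟨hC.toFinset.filter fun c => ∀ d ∈ C, d <+: c → d = c, ?_, ?_⟩
  · intro x hx y hy h
    simp only [Finset.coe_filter, Set.Finite.mem_toFinset, Set.mem_ofPred_eq] at hx hy
    exact hy.2 x hx.1 h
  · have key : ∀ n, ∀ c ∈ C, c.length = n →
        ∃ d ∈ C, (∀ e ∈ C, e <+: d → e = d) ∧ d <+: c := by
      intro n
      induction n using Nat.strong_induction_on with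
      | _ n ih =>
        intro c hc hn
        by_cases h : ∀ e ∈ C, e <+: c → e = c
        · exact ⟨c, hc, h, List.prefix_rfl⟩
        · push Not at h
          obtain ⟨e, he, hec, hne⟩ := h
          have hlt : e.length < n := by
            rw [← hn]
            exact lt_of_le_of_ne hec.length_le fun hl => hne (hec.eq_of_length hl)
          obtain ⟨d, hd, hd1, hd2⟩ := ih _ hlt e he rfl
          exact ⟨d, hd, hd1, hd2.trans hec⟩
    refine hdom.trans (Set.ext fun x => ⟨?_, ?_⟩)
    · rintro ⟨c, hc, w, rfl⟩
      obtain ⟨d, hd, hd1, v, rfl⟩ := key _ c hc rfl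
      exact ⟨d, by simpa using ⟨hd, hd1⟩, v ++ w, by simp⟩
    · rintro ⟨c, hc, w, rfl⟩
      simp only [Finset.coe_filter, Set.Finite.mem_toFinset, Set.mem_ofPred_eq] at hc
      exact ⟨c, hc.1, w, rfl⟩

/-- The value at `x`, or the empty word if there is none. -/
def value (φ : RI k) (x : Word k) : Word k := (φ x).getD []

theorem eq_some_value {φ : RI k} {x : Word k} (h : x ∈ φ.Dom) : φ x = some (φ.value x) := by
  obtain ⟨y, hy⟩ := h
  have : φ x = some y := hy
  simp [value, this]

theorem mem_dom_of_mem {φ : RI k} {P : Set (Word k)} (h : φ.Dom = rightIdealOf P) {x : Word k}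
    (hx : x ∈ P) : x ∈ φ.Dom := h ▸ ⟨x, hx, [], by simp⟩

/-- If φ(x') = φ(x) w, then φ(x') = φ(x w), and injectivity gives x' = x w. Hence injective
homomorphisms carry prefix codes bijectively to prefix codes. -/
theorem value_prefix_value {φ : RI k} (hφ : φ.IsInjective) {x x' : Word k} (hx : x ∈ φ.Dom)
    (hx' : x' ∈ φ.Dom) (h : φ.value x <+: φ.value x') : x <+: x' := by
  obtain ⟨w, hw⟩ := h
  have h1 := φ.map_append _ _ w (eq_some_value hx)
  exact ⟨w, hφ _ _ _ h1 ((eq_some_value hx').trans (congrArg some hw.symm))⟩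

/-- Enumerating the domain code and undoing the enumeration is the identity on the domain of φ, so
the equality holds exactly, before passing to maximal extensions. -/
theorem eq_comp_inverse (hab : a ≠ b) {φ ψ : RI k} {l : List (Word k)}
    (hdom : φ.Dom = rightIdealOf {x | x ∈ l}) (hψ : (enum a b l).IsInverse ψ) :
    φ = (enum a b (l.map φ.value)).comp ψ := by
  rw [← comp_enum hab (f := φ) φ.value fun x hx => eq_some_value (mem_dom_of_mem hdom hx),
    comp_assoc]
  refine ext_some fun x y => ?_
  simp only [comp_eq_some, ← hψ _ _]
  constructor
  · intro h
    have hx : x ∈ rightIdealOf {x | x ∈ l} := hdom ▸ ⟨y, h⟩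
    obtain ⟨p, hp, w, rfl⟩ := hx
    obtain ⟨c, hc⟩ := exists_enum_eq_some hab hp
    exact ⟨p ++ w, ⟨_, hc w, hc w⟩, h⟩
  · rintro ⟨z, ⟨c, h1, h2⟩, h⟩
    rwa [Option.some.inj (h1.symm.trans h2)]

end RI
end ThompsonHigman
namespace ThompsonHigman

open RI

variable {k : ℕ}

/-! ### Tables of the generators. -/

theorem collapsesAtMostOne_of_isInjective {α : RI k} (hα : α.IsInjective) :
    CollapsesAtMostOne (toM α) := by
  classical
  obtain ⟨P, hP, hdom⟩ := α.exists_isPrefixCode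
  have hmem : ∀ x ∈ P, x ∈ α.Dom := fun x hx => mem_dom_of_mem hdom hx
  have hcard : (P.image α.value).card = P.card := by
    refine Finset.card_image_of_injOn fun x hx x' hx' h => ?_
    refine hP x hx x' hx' (value_prefix_value hα (hmem x hx) (hmem x' hx') ?_)
    exact h ▸ List.prefix_rfl
  refine ⟨α, P, P.image α.value, rfl, ⟨hP, ?_, hdom, fun y => ?_⟩, hcard.le, by omega⟩
  · intro y hy y' hy' h
    obtain ⟨x, hx, rfl⟩ := Finset.mem_image.1 (Finset.mem_coe.1 hy)
    obtain ⟨x', hx', rfl⟩ := Finset.mem_image.1 (Finset.mem_coe.1 hy')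
    rw [hP x hx x' hx' (value_prefix_value hα (hmem x hx) (hmem x' hx') h)]
  · rw [Finset.mem_image]
    refine exists_congr fun x => and_congr_right fun hx => ?_
    rw [eq_some_value (hmem x hx), Option.some.injEq]

theorem collapsesAtMostOne_fold {a b : Fin k} (hab : a ≠ b) :
    CollapsesAtMostOne (toM (fold a b)) := by
  refine ⟨fold a b, {[a], [b, a], [b, b]}, {[a], [b]}, rfl, ⟨?_, ?_, ?_, ?_⟩, ?_, ?_⟩
  · simp [IsPrefixCode, hab, hab.symm]
  · simp [IsPrefixCode, hab, hab.symm]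
  · ext x
    simp only [Dom, domain, Set.mem_ofPred_eq, fold, branch_eq_some hab, prepend_apply,
      rightIdealOf]
    constructor
    · rintro ⟨y, ⟨w, rfl, -⟩ | ⟨w, rfl, ⟨v, rfl, -⟩ | ⟨v, rfl, -⟩⟩⟩
      · exact ⟨[a], by simp, w, rfl⟩
      · exact ⟨[b, a], by simp, v, rfl⟩
      · exact ⟨[b, b], by simp, v, rfl⟩
    · rintro ⟨c, hc, w, rfl⟩
      simp only [Finset.coe_insert, Finset.coe_singleton, Set.mem_insert_iff,
        Set.mem_singleton_iff] at hc
      rcases hc with rfl | rfl | rfl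
      · exact ⟨_, Or.inl ⟨w, rfl, rfl⟩⟩
      · exact ⟨_, Or.inr ⟨_, rfl, Or.inl ⟨w, rfl, rfl⟩⟩⟩
      · exact ⟨_, Or.inr ⟨_, rfl, Or.inr ⟨w, rfl, rfl⟩⟩⟩
  · intro y
    simp [fold, branch_right hab, eq_comm]
  · simp [hab]
  · simp [hab]

/-! ### Generation of the two monoids over at least two letters. -/

/-- The classes of the homomorphisms in `s` and of their inverses. -/
noncomputable def symmClasses (s : Set (RI k)) : Set (M k) :=
  toM '' s ∪ (fun α : RI k => toM α.inverse) '' s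

theorem finite_symmClasses {s : Set (RI k)} (hs : s.Finite) : (symmClasses s).Finite :=
  (hs.image _).union (hs.image _)

theorem toM_mem_closure {s : Set (RI k)} {α : RI k} (hα : α ∈ s) :
    toM α ∈ Submonoid.closure (symmClasses s) :=
  Submonoid.subset_closure (Or.inl ⟨α, hα, rfl⟩)

theorem toM_inverse_mem_closure {s : Set (RI k)} {α : RI k} (hα : α ∈ s) :
    toM α.inverse ∈ Submonoid.closure (symmClasses s) :=
  Submonoid.subset_closure (Or.inr ⟨α, hα, rfl⟩)

theorem closure_symmClasses_le {s : Set (RI k)} (hs : ∀ α ∈ s, α.IsInjective) :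
    Submonoid.closure (symmClasses s) ≤ Inv k := by
  rw [Submonoid.closure_le]
  rintro _ (⟨α, hα, rfl⟩ | ⟨α, hα, rfl⟩)
  · exact ⟨α, hs α hα, rfl⟩
  · exact ⟨_, (hs α hα).isInverse_inverse.symm.isInjective, rfl⟩

theorem finite_generators (a b : Fin k) : (generators a b).Finite := by
  unfold generators
  exact Set.toFinite _

section Branch

variable {a b : Fin k}

/-- The predicate carries an inverse along because the factorization of φ needs the inverse of an
enumeration; inverses compose in reverse order. -/
theorem isGenerated_inverse (hab : a ≠ b) :
    IsGenerated a b fun α => toM α ∈ Submonoid.closure (symmClasses (generators a b)) ∧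
      ∃ β, α.IsInverse β ∧ toM β ∈ Submonoid.closure (symmClasses (generators a b)) where
  comp := by
    rintro f g ⟨hf, f', hff', hf'⟩ ⟨hg, g', hgg', hg'⟩
    refine ⟨?_, g'.comp f', hff'.comp hgg', ?_⟩
    · rw [← toM_mul]
      exact mul_mem hf hg
    · rw [← toM_mul]
      exact mul_mem hg' hf'
  mem g hg := ⟨toM_mem_closure hg, g.inverse,
    (isInjective_of_mem_generators hab hg).isInverse_inverse, toM_inverse_mem_closure hg⟩
  inverse_mem g hg := ⟨toM_inverse_mem_closure hg, g,
    (isInjective_of_mem_generators hab hg).isInverse_inverse.symm, toM_mem_closure hg⟩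

/-- The right factor inverts the enumeration of a prefix code, so it is generated without `fold`
even when φ is not injective; only the list of values can require collapsing. -/
theorem exists_toM_eq_mul (hab : a ≠ b) (φ : RI k) :
    ∃ l : List (Word k), l.Nodup ∧ IsPrefixCode {x | x ∈ l} ∧ (∀ x ∈ l, x ∈ φ.Dom) ∧
      ∃ m ∈ Submonoid.closure (symmClasses (generators a b)),
        toM φ = toM (enum a b (l.map φ.value)) * m := by
  obtain ⟨P, hP, hdom⟩ := φ.exists_isPrefixCode
  have hset : (P : Set (Word k)) = {x | x ∈ P.toList} := by
    ext x
    simp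
  rw [hset] at hP hdom
  obtain ⟨-, β, hβ, hm⟩ := (isGenerated_inverse hab).enum_of_isPrefixCode hab P.nodup_toList hP
  exact ⟨P.toList, P.nodup_toList, hP, fun x hx => mem_dom_of_mem hdom hx, toM β, hm,
    (congrArg toM (eq_comp_inverse hab hdom hβ)).trans (toM_mul _ _).symm⟩

theorem closure_generators (hab : a ≠ b) :
    Submonoid.closure (symmClasses (generators a b)) = Inv k := by
  refine le_antisymm (closure_symmClasses_le fun g => isInjective_of_mem_generators hab) ?_
  rintro _ ⟨φ, hφ, rfl⟩
  obtain ⟨l, hn, hl, hdom, m, hm, h⟩ := exists_toM_eq_mul hab φ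
  rw [h]
  refine mul_mem ((isGenerated_inverse hab).enum_of_isPrefixCode hab ?_ ?_).1 hm
  · refine hn.map_on fun x hx x' hx' h => ?_
    exact hl x hx x' hx'
      (value_prefix_value hφ (hdom x hx) (hdom x' hx') (h ▸ List.prefix_rfl))
  · intro y hy y' hy' h
    obtain ⟨x, hx, rfl⟩ := List.mem_map.1 hy
    obtain ⟨x', hx', rfl⟩ := List.mem_map.1 hy'
    rw [hl x hx x' hx' (value_prefix_value hφ (hdom x hx) (hdom x' hx') h)]

theorem closure_generators_union_fold (hab : a ≠ b) :
    Submonoid.closure (symmClasses (generators a b) ∪ {toM (fold a b)}) = ⊤ := by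
  have hle : Submonoid.closure (symmClasses (generators a b)) ≤
      Submonoid.closure (symmClasses (generators a b) ∪ {toM (fold a b)}) :=
    Submonoid.closure_mono Set.subset_union_left
  have hK : IsGenerated a b fun α =>
      toM α ∈ Submonoid.closure (symmClasses (generators a b) ∪ {toM (fold a b)}) :=
    { comp := fun f g hf hg => by
        rw [← toM_mul]
        exact mul_mem hf hg
      mem := fun g hg => hle (toM_mem_closure hg)
      inverse_mem := fun g hg => hle (toM_inverse_mem_closure hg) }
  refine eq_top_iff.2 fun φ _ => ?_
  obtain ⟨l, -, -, -, m, hm, h⟩ := exists_toM_eq_mul hab φ.1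
  rw [← toM_val φ, h]
  exact mul_mem (hK.enum_of_fold hab (Submonoid.subset_closure (Or.inr rfl)) _) (hle hm)

end Branch

/-! ### Alphabets with at most one letter. -/

/-- Over an alphabet with at most one letter, these and their inverses generate `M k`. -/
def letterMaps (k : ℕ) : Set (RI k) := insert (zero k) (Set.range fun j : Fin k => prepend [j])

theorem toM_prepend_mem (v : Word k) :
    toM (prepend v) ∈ Submonoid.closure (symmClasses (letterMaps k)) := by
  induction v with
  | nil => exact one_mem (Submonoid.closure (symmClasses (letterMaps k)))
  | cons j v ih =>
    have h := mul_mem (toM_mem_closure (Or.inr ⟨j, rfl⟩ : prepend [j] ∈ letterMaps k)) ih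
    rwa [toM_mul, prepend_comp_prepend] at h

theorem exists_isInverse_prepend (v : Word k) :
    ∃ β, (prepend v).IsInverse β ∧
      toM β ∈ Submonoid.closure (symmClasses (letterMaps k)) := by
  induction v with
  | nil => exact ⟨prepend [], fun x y => by simp [eq_comm], toM_prepend_mem []⟩
  | cons j v ih =>
    obtain ⟨β, hβ, hm⟩ := ih
    have hj : prepend [j] ∈ letterMaps k := Or.inr ⟨j, rfl⟩
    refine ⟨β.comp (prepend [j]).inverse, ?_, ?_⟩
    · rw [← List.singleton_append, ← prepend_comp_prepend]
      exact (prepend_isInjective _).isInverse_inverse.comp hβ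
    · rw [← toM_mul]
      exact mul_mem hm (toM_inverse_mem_closure hj)

section Subsingleton

variable [Subsingleton (Fin k)]

theorem prefix_total (x y : Word k) : x <+: y ∨ y <+: x := by
  induction x generalizing y with
  | nil => exact Or.inl List.nil_prefix
  | cons i x ih =>
    cases y with
    | nil => exact Or.inr List.nil_prefix
    | cons j y =>
      obtain rfl := Subsingleton.elim i j
      simpa using ih y

/-- Any two words are prefix-comparable, and φ(x w) = φ(x) w equals φ(x) only for empty w. -/
theorem isInjective_of_subsingleton (φ : RI k) : φ.IsInjective := by
  have key : ∀ x w y, φ x = some y → φ (x ++ w) = some y → x = x ++ w := by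
    intro x w y h h'
    have := Option.some.inj ((φ.map_append _ _ w h).symm.trans h')
    simpa using this
  intro x x' y h h'
  rcases prefix_total x x' with ⟨w, rfl⟩ | ⟨w, rfl⟩
  · exact key _ _ _ h h'
  · exact (key _ _ _ h' h).symm

theorem toM_mem_closure_letterMaps (φ : RI k) :
    toM φ ∈ Submonoid.closure (symmClasses (letterMaps k)) := by
  by_cases h : ∃ x y, φ x = some y
  · obtain ⟨x, y, hxy⟩ := h
    obtain ⟨β, hβ, hm⟩ := exists_isInverse_prepend x
    -- One pair x ↦ y suffices: any other word of the domain either extends x or is a prefix of x,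
    -- and in the latter case can be lengthened to x.
    have hφ : φ.IsEssentialExtension ((prepend y).comp β) := by
      rw [isEssentialExtension_iff]
      constructor
      · intro u v huv
        obtain ⟨z, hz, hv⟩ := comp_eq_some.1 huv
        obtain rfl := Option.some.inj ((hβ z u).2 hz)
        obtain rfl := Option.some.inj hv
        exact φ.map_append _ _ _ hxy
      · intro u v huv
        rcases prefix_total x u with ⟨w, rfl⟩ | ⟨w, rfl⟩
        · refine ⟨[], comp_eq_some.2 ⟨w, (hβ _ _).1 (by simp), ?_⟩⟩
          rw [← (φ.map_append _ _ w hxy).symm.trans huv |> Option.some.inj]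
          simp
        · refine ⟨w, comp_eq_some.2 ⟨[], (hβ _ _).1 (by simp), ?_⟩⟩
          rw [Option.some.inj ((φ.map_append _ _ w huv).symm.trans hxy)]
          simp
    have h1 : toM φ = toM (prepend y) * toM β := by
      rw [toM_mul]
      exact Subtype.ext (max_eq_of_isEssentialExtension hφ)
    rw [h1]
    exact mul_mem (toM_prepend_mem y) hm
  · have h0 : φ = zero k := ext_some fun x y => by
      simpa using fun hxy => h ⟨x, y, hxy⟩
    rw [h0]
    exact toM_mem_closure (Or.inl rfl)

theorem closure_letterMaps : Submonoid.closure (symmClasses (letterMaps k)) = ⊤ :=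
  eq_top_iff.2 fun φ _ => toM_val φ ▸ toM_mem_closure_letterMaps φ.1

end Subsingleton

/-! ### Assembly of the generating sets. -/

theorem exists_generators (k : ℕ) : ∃ S T : Set (M k),
    S.Finite ∧ Submonoid.closure S = Inv k ∧ T.Finite ∧ T.ncard ≤ k ∧
      Submonoid.closure (S ∪ T) = ⊤ ∧ ∀ φ ∈ T, CollapsesAtMostOne φ := by
  -- For k < 2 the set T is empty, as `Inv k` is everything; for k ≥ 2 the single class of `fold`
  -- suffices.
  rcases Nat.lt_or_ge k 2 with hk | hk
  · have : Subsingleton (Fin k) := Fin.subsingleton_iff_le_one.2 (by omega)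
    refine ⟨symmClasses (letterMaps k), ∅,
      finite_symmClasses ((Set.finite_range _).insert _), ?_, Set.finite_empty, by simp,
      by rw [Set.union_empty, closure_letterMaps], by simp⟩
    refine le_antisymm (closure_symmClasses_le fun α _ => isInjective_of_subsingleton α) ?_
    rw [closure_letterMaps]
    exact le_top
  · have hab : (⟨0, by omega⟩ : Fin k) ≠ ⟨1, by omega⟩ := by simp
    refine ⟨symmClasses (generators _ _), {toM (fold _ _)},
      finite_symmClasses (finite_generators _ _), closure_generators hab, Set.finite_singleton _, ?_,
      closure_generators_union_fold hab, ?_⟩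
    · rw [Set.ncard_singleton]
      omega
    · rintro _ rfl
      exact collapsesAtMostOne_fold hab

end ThompsonHigman

theorem theorem3p4 (k : ℕ) :
    Monoid.FG (ThompsonHigman.M k) ∧
    (∀ φ : ThompsonHigman.M k, ∃ l : List (ThompsonHigman.M k),
      (∀ ψ ∈ l, ThompsonHigman.CollapsesAtMostOne ψ) ∧ l.prod = φ) ∧
    (∃ S T : Set (ThompsonHigman.M k),
      S.Finite ∧ Submonoid.closure S = ThompsonHigman.Inv k ∧
      T.Finite ∧ T.ncard ≤ k ∧ Submonoid.closure (S ∪ T) = ⊤) := by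
  obtain ⟨S, T, hS, hSInv, hT, hTk, hST, hcol⟩ := ThompsonHigman.exists_generators k
  refine ⟨Monoid.fg_iff.2 ⟨S ∪ T, hST, hS.union hT⟩, fun φ => ?_,
    S, T, hS, hSInv, hT, hTk, hST⟩
  obtain ⟨l, hl, hprod⟩ := Submonoid.exists_list_of_mem_closure
    (show φ ∈ Submonoid.closure (S ∪ T) from hST ▸ Submonoid.mem_top φ)
  refine ⟨l, fun ψ hψ => ?_, hprod⟩
  rcases hl ψ hψ with h | h
  · obtain ⟨α, hα, rfl⟩ : ψ ∈ ThompsonHigman.Inv k := hSInv ▸ Submonoid.subset_closure h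
    exact ThompsonHigman.collapsesAtMostOne_of_isInjective hα
  · exact hcol ψ h
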